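/- All rings are associative with $1$. For a finite ring $R$, let $G_R$ be its unitary Cayley graph: the simple graph with vertex set $R$ in which two distinct elements $a,b$ are adjacent if and only if $a-b$ is invertible in $R$. Let $R^{\mathrm{ss}} = R/\mathrm{Rad}(R)$ be the semisimplification of $R$, where $\mathrm{Rad}(R)$ is the Jacobson radical. A finite graph is perfect if, for each of its induced subgraphs $H$, the chromatic number of $H$ equals the size of a maximum clique of $H$. **Theorem.** Let $R$ be a finite ring whose semisimplification has a decomposition $$R^{\mathrm{ss}} \cong \prod_{i=1}^{s} R_i \times \prod_{j=1}^{r} M_{d_j}(F_j),$$ where $s, r \ge 0$, the $R_i$ are finite fields with $2 \le |R_1| \le |R_2| \le \dots \le |R_s|$, the $F_j$ are finite fields, and $d_j \ge 2$ for all $j$. Then $G_R$ is perfect if and only if at least one of the following conditions holds: 1. $s \ge 1$ and $|R_1| = 2$; 2. $r = 0$ and $s \le 2$; 3. $R^{\mathrm{ss}} \cong M_2(\mathbb{F}_2)$ as rings. Moreover, if condition 1 holds, then $G_R$ is bipartite. -/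

import Mathlib

namespace UnitaryCayley

/-- The unitary Cayley graph `G_R` of a ring `R`: the vertices are the elements of `R`, and two
distinct vertices `a`, `b` are adjacent iff `a - b` is invertible. (If `R` is nontrivial, then
`IsUnit (a - b)` already forces `a ≠ b`; the clause `a ≠ b` only discards the loop that the
zero ring would have.) -/
def unitaryCayleyGraph (R : Type*) [Ring R] : SimpleGraph R where
  Adj a b := a ≠ b ∧ IsUnit (a - b)
  symm := ⟨fun a b h => ⟨h.1.symm, by
    have h2 := h.2.neg
    rwa [neg_sub] at h2⟩⟩
  loopless := ⟨fun _ h => h.1 rfl⟩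

/-- A finite graph is perfect if the chromatic number of each of its induced subgraphs equals
the size of a maximum clique of that subgraph. -/
def IsPerfect {V : Type*} [Finite V] (G : SimpleGraph V) : Prop :=
  ∀ S : Set V, (G.induce S).chromaticNumber = ((G.induce S).cliqueNum : ℕ∞)

/-- The semisimplification `R^ss = R / Rad(R)`, where `Rad(R)` is the Jacobson radical. -/
abbrev Semisimplification (R : Type*) [Ring R] : Type _ := R ⧸ Ring.jacobson R

end UnitaryCayley

/-!
Let `R^ss` be the semisimplification. An element of `R` is a unit as soon as its image in `R^ss` is
one, so adjacency in `G_R` can be read off in `R^ss`.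

A factor `𝔽_2` of `R^ss` yields a homomorphism from `G_R` to `K_2`. Otherwise every factor contains
a triangle `0, 1, w`, and running along its edges gives a closed 5-walk two of whose five chords
are non-edges, in any prescribed cyclic position. The chords of a closed walk in a product are
non-edges as soon as they are so in one factor, hence three factors suffice for an induced 5-cycle.
A matrix ring other than `M_2(𝔽_2)` has an induced 5-cycle by itself, and `M_2(𝔽_2)` has a closed
5-walk with three non-edges as chords, which any further factor completes to an induced 5-cycle.

There remain products of at most two fields, where `G_R` comes from the complement of a rook's
graph, and `M_2(𝔽_2)`, whose graph is the `4 × 4` rook's graph. Both graphs are perfect by the two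
theorems of König on bipartite graphs: maximum matchings are as large as minimum vertex covers, and
the chromatic index equals the maximum degree.
-/

namespace UnitaryCayley

open Finset SimpleGraph

section Perfect

variable {V W : Type*} [Finite V] {G : SimpleGraph V}

theorem IsPerfect.of_forall_exists_colorable
    (h : ∀ S : Set V, ∃ n, (G.induce S).Colorable n ∧ ¬(G.induce S).CliqueFree n) :
    IsPerfect G := by
  intro S
  obtain ⟨n, hcol, hclique⟩ := h S
  obtain ⟨t, ht⟩ : ∃ t, (G.induce S).IsNClique n t := by simpa [CliqueFree] using hclique
  have hn : n ≤ (G.induce S).cliqueNum := ht.card_eq ▸ ht.isClique.card_le_cliqueNum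
  exact le_antisymm (hcol.chromaticNumber_le.trans (mod_cast hn)) cliqueNum_le_chromaticNumber

theorem IsPerfect.colorable_cliqueNum (hG : IsPerfect G) (S : Set V) :
    (G.induce S).Colorable (G.induce S).cliqueNum :=
  chromaticNumber_le_iff_colorable.1 (hG S).le

theorem IsPerfect.colorable_of_cliqueFree (hG : IsPerfect G) {n : ℕ}
    (hn : G.CliqueFree (n + 1)) : G.Colorable n := by
  obtain ⟨t, ht⟩ := (G.induce Set.univ).exists_isNClique_cliqueNum
  have hle : (G.induce Set.univ).cliqueNum ≤ n := by
    by_contra! hlt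
    exact (hn.mono hlt).comap ⟨(Embedding.induce Set.univ).toCopy⟩ t ht
  exact ((hG.colorable_cliqueNum Set.univ).mono hle).of_hom (induceUnivIso G).symm.toHom

theorem IsPerfect.comap [Finite W] {H : SimpleGraph W} (hH : IsPerfect H) (f : V → W)
    (hf : ∀ a b, G.Adj a b ↔ H.Adj (f a) (f b)) : IsPerfect G := by
  refine .of_forall_exists_colorable fun S => ⟨(H.induce (f '' S)).cliqueNum, ?_, ?_⟩
  · let toImage : G.induce S →g H.induce (f '' S) :=
      ⟨fun a => ⟨f a, Set.mem_image_of_mem f a.2⟩, fun hab => (hf _ _).1 hab⟩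
    exact (hH.colorable_cliqueNum _).of_hom toImage
  · intro hfree
    choose g hg using fun y : (f '' S : Set W) => y.2
    let fromImage : H.induce (f '' S) ↪g G.induce S :=
      { toFun y := ⟨g y, (hg y).1⟩
        inj' x y hxy :=
          Subtype.ext <| (hg x).2.symm.trans <| (congrArg (fun z => f z.1) hxy).trans (hg y).2
        map_rel_iff' {x y} := by
          change G.Adj (g x) (g y) ↔ H.Adj x y
          rw [hf, (hg x).2, (hg y).2] }
    obtain ⟨t, ht⟩ := (H.induce (f '' S)).exists_isNClique_cliqueNum
    exact hfree.comap ⟨fromImage.toCopy⟩ t ht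

theorem IsPerfect.of_isBipartite (hG : G.IsBipartite) : IsPerfect G := by
  refine .of_forall_exists_colorable fun S => ?_
  by_cases h2 : (G.induce S).CliqueFree 2
  · have hbot : G.induce S = ⊥ := cliqueFree_two.1 h2
    rcases isEmpty_or_nonempty S with hS | hS
    · exact ⟨0, .of_isEmpty 0, not_cliqueFree_zero⟩
    · exact ⟨1, hbot ▸ ⟨Coloring.mk (fun _ => 0) (by simp)⟩, by simp [cliqueFree_one]⟩
  · exact ⟨2, hG.of_hom (Embedding.induce S).toHom, h2⟩

theorem not_isPerfect_cycleGraph_five : ¬IsPerfect (cycleGraph 5) := by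
  intro hperf
  have hfree : (cycleGraph 5).CliqueFree 3 := by
    intro t ht
    obtain ⟨a, b, c, hab, hac, hbc, -⟩ := is3Clique_iff.1 ht
    revert a b c
    decide
  have hle := (hperf.colorable_of_cliqueFree hfree).chromaticNumber_le
  rw [chromaticNumber_cycleGraph_of_odd 5 (by norm_num) (by decide)] at hle
  exact absurd hle (by decide)

end Perfect

section Rook

theorem not_cliqueFree_card_of_hom_top {V C : Type*} [Fintype C] {G : SimpleGraph V}
    (f : (⊤ : SimpleGraph C) →g G) : ¬G.CliqueFree (Fintype.card C) :=
  fun h => h _ (isNClique_map_copy_top ⟨f, Hom.injective_of_top_hom f⟩)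

/-- The pair `(A, B)` is a vertex cover of minimum size of the bipartite graph given by the
relation `r`, where `A` consists of left and `B` of right vertices. -/
structure IsMinimumCover {α β : Type*} (r : α → β → Prop) (A : Finset α) (B : Finset β) :
    Prop where
  cover : ∀ a b, r a b → a ∈ A ∨ b ∈ B
  minimum : ∀ (A' : Finset α) (B' : Finset β), (∀ a b, r a b → a ∈ A' ∨ b ∈ B') →
    #A + #B ≤ #A' + #B'

variable {α β : Type*}

theorem exists_isMinimumCover [Finite α] [Finite β] (r : α → β → Prop) :
    ∃ A B, IsMinimumCover r A B := by
  have := Fintype.ofFinite α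
  have := Fintype.ofFinite β
  obtain ⟨⟨A, B⟩, hcover, hmin⟩ := Set.exists_min_image
    {P : Finset α × Finset β | ∀ a b, r a b → a ∈ P.1 ∨ b ∈ P.2} (fun P => #P.1 + #P.2)
    (Set.toFinite _) ⟨(univ, univ), by simp⟩
  exact ⟨A, B, hcover, fun A' B' h => hmin (A', B') h⟩

theorem IsMinimumCover.swap {r : α → β → Prop} {A : Finset α} {B : Finset β}
    (h : IsMinimumCover r A B) : IsMinimumCover (fun b a => r a b) B A where
  cover b a hab := (h.cover a b hab).symm
  minimum B' A' h' := by
    simpa only [add_comm] using h.minimum A' B' fun a b hab => (h' b a hab).symm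

theorem IsMinimumCover.exists_injective [Finite β] {r : α → β → Prop} {A : Finset α}
    {B : Finset β} (h : IsMinimumCover r A B) :
    ∃ f : A → β, Function.Injective f ∧ ∀ a, f a ∉ B ∧ r a (f a) := by
  classical
  have := Fintype.ofFinite β
  refine (Fintype.all_card_le_filter_rel_iff_exists_injective
    fun (a : A) b => b ∉ B ∧ r a b).1 fun X => ?_
  -- Hall's condition: otherwise replacing `X` by its neighbours outside `B` shrinks the cover.
  set N : Finset β := {b | ∃ a ∈ X, b ∉ B ∧ r a b}
  have hcover : ∀ a b, r a b → a ∈ A \ X.map (.subtype _) ∨ b ∈ B ∪ N := by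
    intro a b hab
    have := h.cover a b hab
    simp only [mem_sdiff, mem_map, mem_union, N, mem_filter, mem_univ, true_and,
      Function.Embedding.subtype_apply, Subtype.exists]
    grind
  have hmin := h.minimum _ _ hcover
  have hX : X.map (.subtype _) ⊆ A := map_subtype_subset X
  have hsdiff := card_sdiff_add_card_eq_card hX
  rw [card_map] at hsdiff
  have hunion := card_union_le B N
  lia

theorem compl_boxProd_top_adj {x y : α × β} :
    ((⊤ : SimpleGraph α) □ (⊤ : SimpleGraph β))ᶜ.Adj x y ↔ x.1 ≠ y.1 ∧ x.2 ≠ y.2 := by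
  simp only [compl_adj, boxProd_adj, top_adj, ne_eq, Prod.ext_iff]
  tauto

/-- König's theorem on matchings and vertex covers: the vertex set of an induced subgraph is the
edge set of a bipartite graph, whose matchings are the cliques. -/
theorem isPerfect_compl_boxProd_top [Finite α] [Finite β] :
    IsPerfect ((⊤ : SimpleGraph α) □ (⊤ : SimpleGraph β))ᶜ := by
  classical
  refine .of_forall_exists_colorable fun S => ?_
  obtain ⟨A, B, hAB⟩ := exists_isMinimumCover fun a b => (a, b) ∈ S
  obtain ⟨f, hf, hfB⟩ := hAB.exists_injective
  obtain ⟨g, hg, hgA⟩ := hAB.swap.exists_injective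
  refine ⟨Fintype.card (A ⊕ B), ?_, ?_⟩
  · let color (x : S) : A ⊕ B :=
      if ha : x.1.1 ∈ A then .inl ⟨x.1.1, ha⟩
      else .inr ⟨x.1.2, (hAB.cover _ _ x.2).resolve_left ha⟩
    refine (Coloring.mk color fun {x y} hxy => ?_).colorable
    have hne : x.1.1 ≠ y.1.1 ∧ x.1.2 ≠ y.1.2 := compl_boxProd_top_adj.1 hxy
    grind
  · let matching : A ⊕ B → S := Sum.elim (fun a => ⟨(a, f a), (hfB a).2⟩)
      (fun b => ⟨(g b, b), (hgA b).2⟩)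
    refine not_cliqueFree_card_of_hom_top ⟨matching, ?_⟩
    rintro (a | b) (a' | b') hne <;> refine compl_boxProd_top_adj.2 ?_
    · have hne : a ≠ a' := fun h => hne (congrArg Sum.inl h)
      exact ⟨Subtype.coe_ne_coe.2 hne, hf.ne hne⟩
    · exact ⟨ne_of_mem_of_not_mem a.2 (hgA b').1, (ne_of_mem_of_not_mem b'.2 (hfB a).1).symm⟩
    · exact ⟨(ne_of_mem_of_not_mem a'.2 (hgA b).1).symm, ne_of_mem_of_not_mem b.2 (hfB a').1⟩
    · have hne : b ≠ b' := fun h => hne (congrArg Sum.inr h)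
      exact ⟨hg.ne hne, Subtype.coe_ne_coe.2 hne⟩

/-- Birkhoff's theorem: up to scaling, a matrix with constant line sums is doubly stochastic. -/
theorem exists_perm_forall_ne_zero {n : Type*} [Fintype n] {k : ℕ} (hk : k ≠ 0)
    {M : Matrix n n ℕ} (hrow : ∀ i, ∑ j, M i j = k) (hcol : ∀ j, ∑ i, M i j = k) :
    ∃ σ : Equiv.Perm n, ∀ i, M i (σ i) ≠ 0 := by
  classical
  have hstoch : M.map (fun m => (m / k : ℚ)) ∈ doublyStochastic ℚ n := by
    have hk' : (k : ℚ) ≠ 0 := mod_cast hk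
    simp only [mem_doublyStochastic_iff_sum, Matrix.map_apply, ← sum_div, ← Nat.cast_sum, hrow,
      hcol, div_self hk', implies_true, and_true]
    intros
    positivity
  obtain ⟨w, hw, hsum, hM⟩ := exists_eq_sum_perm_of_mem_doublyStochastic hstoch
  obtain ⟨σ, -, hσ⟩ := exists_ne_zero_of_sum_ne_zero (hsum.trans_ne one_ne_zero)
  refine ⟨σ, fun i hi => hσ (le_antisymm ?_ (hw σ))⟩
  calc w σ = (w σ • σ.permMatrix ℚ) i (σ i) := by simp [PEquiv.toMatrix_apply]
    _ ≤ ∑ τ, (w τ • τ.permMatrix ℚ) i (σ i) :=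
      single_le_sum (f := fun τ => (w τ • τ.permMatrix ℚ) i (σ i))
        (fun τ _ => mul_nonneg (hw τ) (by simp only [PEquiv.toMatrix_apply]; positivity))
        (mem_univ σ)
    _ = 0 := by rw [← Matrix.sum_apply, hM, Matrix.map_apply, hi, Nat.cast_zero, zero_div]

theorem exists_perms_cover {n : Type*} [Fintype n] (k : ℕ) (M : Matrix n n ℕ)
    (hrow : ∀ i, ∑ j, M i j = k) (hcol : ∀ j, ∑ i, M i j = k) :
    ∃ σ : Fin k → Equiv.Perm n, ∀ i j, M i j ≠ 0 → ∃ c, σ c i = j := by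
  classical
  induction k generalizing M with
  | zero => exact ⟨Fin.elim0, fun i j hij => absurd (sum_eq_zero_iff.1 (hrow i) j (mem_univ j)) hij⟩
  | succ k ih =>
    obtain ⟨σ, hσ⟩ := exists_perm_forall_ne_zero k.succ_ne_zero hrow hcol
    let M' : Matrix n n ℕ := fun i j => M i j - if σ i = j then 1 else 0
    have hM' (i j) : M i j = M' i j + if σ i = j then 1 else 0 := by
      have := hσ i
      grind
    obtain ⟨τ, hτ⟩ := ih M'
      (fun i => by simpa [hM', sum_add_distrib] using hrow i)
      (fun j => by simpa [hM', sum_add_distrib, ← Equiv.eq_symm_apply] using hcol j)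
    refine ⟨Fin.cons σ τ, fun i j hij => ?_⟩
    by_cases hσj : σ i = j
    · exact ⟨0, hσj⟩
    · obtain ⟨c, hc⟩ := hτ i j (by simpa [hM', hσj] using hij)
      exact ⟨c.succ, hc⟩

/-- Two transposed copies of `N`, joined by multiple edges, make up a square matrix with constant
line sums. -/
theorem exists_perms_sum_cover [Fintype α] [Fintype β] {k : ℕ} {N : Matrix α β ℕ}
    (hrow : ∀ a, ∑ b, N a b ≤ k) (hcol : ∀ b, ∑ a, N a b ≤ k) :
    ∃ σ : Fin k → Equiv.Perm (α ⊕ β), ∀ a b, N a b ≠ 0 → ∃ c, σ c (.inl a) = .inr b := by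
  classical
  obtain ⟨σ, hσ⟩ := exists_perms_cover k
    (Matrix.fromBlocks (.diagonal fun a => k - ∑ b, N a b) N
      N.transpose (.diagonal fun b => k - ∑ a, N a b))
    (by rintro (a | b) <;> simp [Matrix.diagonal_apply, hrow, hcol])
    (by rintro (a | b) <;> simp [Matrix.diagonal_apply, hrow, hcol])
  exact ⟨σ, fun a b => hσ (.inl a) (.inr b)⟩

/-- König's theorem on edge colourings, with the elements of `S` as the edges of a bipartite
graph. -/
theorem colorable_induce_boxProd_top [Finite α] [Finite β] [DecidableEq α] [DecidableEq β]
    {S : Set (α × β)} [Fintype S] {k : ℕ} (hrow : ∀ a, #{x : S | x.1.1 = a} ≤ k)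
    (hcol : ∀ b, #{x : S | x.1.2 = b} ≤ k) :
    (((⊤ : SimpleGraph α) □ (⊤ : SimpleGraph β)).induce S).Colorable k := by
  have := Fintype.ofFinite α
  have := Fintype.ofFinite β
  let N : Matrix α β ℕ := fun a b => #{x : S | x.1.1 = a ∧ x.1.2 = b}
  have hNrow (a) : ∑ b, N a b = #{x : S | x.1.1 = a} := by
    rw [card_eq_sum_card_fiberwise (f := fun x : S => x.1.2) (t := univ) (by simp)]
    simp only [N, filter_filter]
  have hNcol (b) : ∑ a, N a b = #{x : S | x.1.2 = b} := by
    rw [card_eq_sum_card_fiberwise (f := fun x : S => x.1.1) (t := univ) (by simp)]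
    simp only [N, filter_filter, and_comm]
  obtain ⟨σ, hσ⟩ := exists_perms_sum_cover (fun a => (hNrow a).trans_le (hrow a))
    fun b => (hNcol b).trans_le (hcol b)
  choose color hcolor using fun x : S => hσ x.1.1 x.1.2 (card_ne_zero_of_mem (a := x) (by simp))
  refine ⟨Coloring.mk color fun {x y} hxy hc => ?_⟩
  have hx := hcolor x
  rw [hc] at hx
  rcases hxy with ⟨hne, heq⟩ | ⟨hne, heq⟩
  · exact hne (Sum.inl_injective ((σ _).injective (hx.trans (heq ▸ (hcolor y).symm))))
  · exact hne (Sum.inr_injective (hx.symm.trans (heq ▸ hcolor y)))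

theorem isPerfect_boxProd_top [Finite α] [Finite β] :
    IsPerfect ((⊤ : SimpleGraph α) □ (⊤ : SimpleGraph β)) := by
  classical
  have := Fintype.ofFinite α
  have := Fintype.ofFinite β
  refine .of_forall_exists_colorable fun S => ?_
  rcases isEmpty_or_nonempty S with hS | ⟨⟨x₀, _⟩⟩
  · exact ⟨0, .of_isEmpty 0, not_cliqueFree_zero⟩
  let line (l : α ⊕ β) : Finset S := {x | l.elim (x.1.1 = ·) (x.1.2 = ·)}
  obtain ⟨l, -, hl⟩ := exists_mem_eq_sup univ ⟨.inl x₀.1, mem_univ _⟩ fun l => #(line l)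
  set k := univ.sup fun l => #(line l)
  have hle (l) : #(line l) ≤ k := le_sup (f := fun l => #(line l)) (mem_univ l)
  refine ⟨k, colorable_induce_boxProd_top (fun a => hle (.inl a)) (fun b => hle (.inr b)),
    fun hfree => hfree (line l) ⟨?_, hl.symm⟩⟩
  rcases l with a | b <;> intro x hx y hy hne
  · have hxy : x.1.1 = y.1.1 := (mem_filter.1 hx).2.trans (mem_filter.1 hy).2.symm
    exact .inr ⟨fun h => hne (Subtype.ext (Prod.ext hxy h)), hxy⟩
  · have hxy : x.1.2 = y.1.2 := (mem_filter.1 hx).2.trans (mem_filter.1 hy).2.symm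
    exact .inl ⟨fun h => hne (Subtype.ext (Prod.ext h hxy)), hxy⟩

end Rook

section ExceptionalUnit

/-- An exceptional unit is a unit `w` such that `1 - w` is a unit as well: `0`, `1`, `w` then form
a triangle in the unitary Cayley graph. -/
def HasExceptionalUnit (R : Type*) [Ring R] : Prop :=
  ∃ w : R, IsUnit w ∧ IsUnit (1 - w)

theorem HasExceptionalUnit.map {R T : Type*} [Ring R] [Ring T] (h : HasExceptionalUnit R)
    (φ : R →+* T) : HasExceptionalUnit T := by
  obtain ⟨w, hw, hw'⟩ := h
  exact ⟨φ w, hw.map φ, by simpa using hw'.map φ⟩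

theorem HasExceptionalUnit.pi {ι : Type*} {X : ι → Type*} [∀ k, Ring (X k)]
    (h : ∀ k, HasExceptionalUnit (X k)) : HasExceptionalUnit (∀ k, X k) := by
  choose w hw hw' using h
  exact ⟨w, Pi.isUnit_iff.2 hw, Pi.isUnit_iff.2 hw'⟩

theorem hasExceptionalUnit_of_card_ne_two {F : Type*} [DivisionRing F] (hF : Nat.card F ≠ 2) :
    HasExceptionalUnit F := by
  obtain ⟨t, ht0, ht1⟩ : ∃ t : F, t ≠ 0 ∧ t ≠ 1 := by
    by_contra! h
    exact hF ((Nat.card_eq_two_iff' 0).2 ⟨1, one_ne_zero, h⟩)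
  exact ⟨t, ht0.isUnit, (sub_ne_zero.2 ht1.symm).isUnit⟩

open Polynomial in
theorem hasExceptionalUnit_matrix {n R : Type*} [Fintype n] [DecidableEq n] [CommRing R]
    (hn : 2 ≤ Fintype.card n) : HasExceptionalUnit (Matrix n n R) := by
  cases subsingleton_or_nontrivial R
  · exact ⟨0, isUnit_of_subsingleton _, isUnit_of_subsingleton _⟩
  obtain ⟨m, hm⟩ := Nat.exists_eq_add_of_le' hn
  -- A root `α` of `p` satisfies `α * (1 - α ^ (m + 1)) = 1` and `1 - α = -α ^ (m + 2)`.
  let p : R[X] := X ^ (m + 2) + (1 - X)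
  have hdeg : (1 - X : R[X]).degree < (m + 2 : ℕ) := by
    refine (degree_sub_le _ _).trans_lt ?_
    rw [degree_one, degree_X, max_lt_iff]
    norm_cast
    lia
  have hp : p.Monic := monic_X_pow_add hdeg
  have hpdeg : p.natDegree = Fintype.card n := by
    rw [hm, natDegree_add_eq_left_of_degree_lt (by rwa [degree_X_pow]), natDegree_X_pow]
  let b := (AdjoinRoot.powerBasis' hp).basis.reindex
    ((finCongr hpdeg).trans (Fintype.equivFin n).symm)
  suffices h : HasExceptionalUnit (AdjoinRoot p) from
    h.map (Algebra.leftMulMatrix b).toRingHom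
  let α := AdjoinRoot.root p
  have hα : α ^ (m + 2) + (1 - α) = 0 := by
    have hroot := AdjoinRoot.eval₂_root p
    simpa only [p, eval₂_add, eval₂_sub, eval₂_X_pow, eval₂_X, eval₂_one] using hroot
  have hα1 : α * (1 - α ^ (m + 1)) = 1 := by linear_combination -hα
  have hunit : IsUnit α := .of_mul_eq_one _ hα1
  refine ⟨α, hunit, ?_⟩
  rw [show 1 - α = -α ^ (m + 2) by linear_combination hα]
  exact (hunit.pow _).neg

end ExceptionalUnit

section Pentagon

/-- `HasPentagon R D` says that the unitary Cayley graph of `R` has a closed walk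
`p 0, …, p 4` of length five such that `p i` and `p (i + 2)` are not adjacent for `i ∈ D`. As `D`
grows to all of `Fin 5`, the walk becomes an induced 5-cycle; the sets `D` of several factors of a
ring add up. -/
def HasPentagon (R : Type*) [Ring R] (D : Set (Fin 5)) : Prop :=
  ∃ p : Fin 5 → R, (∀ i, IsUnit (p i - p (i + 1))) ∧ ∀ i ∈ D, ¬IsUnit (p i - p (i + 2))

variable {R T : Type*} [Ring R] [Ring T] {D E : Set (Fin 5)}

theorem HasPentagon.mono (h : HasPentagon R E) (hDE : D ⊆ E) : HasPentagon R D :=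
  let ⟨p, hedge, hchord⟩ := h
  ⟨p, hedge, fun i hi => hchord i (hDE hi)⟩

theorem HasPentagon.map {Φ : Type*} [FunLike Φ R T] [RingHomClass Φ R T] (h : HasPentagon R D)
    (φ : Φ) [IsLocalHom φ] : HasPentagon T D := by
  obtain ⟨p, hedge, hchord⟩ := h
  refine ⟨fun i => φ (p i), fun i => ?_, fun i hi => ?_⟩ <;> rw [← map_sub, isUnit_map_iff]
  exacts [hedge i, hchord i hi]

theorem HasPentagon.of_surjective (h : HasPentagon T D) (φ : R →+* T) [IsLocalHom φ]
    (hφ : Function.Surjective φ) : HasPentagon R D := by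
  obtain ⟨p, hedge, hchord⟩ := h
  choose g hg using hφ
  refine ⟨fun i => g (p i), fun i => ?_, fun i hi => ?_⟩ <;>
    rw [← isUnit_map_iff φ, map_sub, hg, hg]
  exacts [hedge i, hchord i hi]

theorem HasPentagon.prod (hR : HasPentagon R D) (hT : HasPentagon T E) :
    HasPentagon (R × T) (D ∪ E) := by
  obtain ⟨p, hpedge, hpchord⟩ := hR
  obtain ⟨q, hqedge, hqchord⟩ := hT
  refine ⟨fun i => (p i, q i), fun i => Prod.isUnit_iff.2 ⟨hpedge i, hqedge i⟩, ?_⟩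
  rintro i (hi | hi) hu
  · exact hpchord i hi (Prod.isUnit_iff.1 hu).1
  · exact hqchord i hi (Prod.isUnit_iff.1 hu).2

theorem HasPentagon.pi {ι : Type*} {X : ι → Type*} [∀ k, Ring (X k)] {D : ι → Set (Fin 5)}
    (h : ∀ k, HasPentagon (X k) (D k)) : HasPentagon (∀ k, X k) (⋃ k, D k) := by
  choose p hedge hchord using h
  refine ⟨fun i k => p k i, fun i => Pi.isUnit_iff.2 fun k => hedge k i, fun i hi hu => ?_⟩
  obtain ⟨k, hk⟩ := Set.mem_iUnion.1 hi
  exact hchord k i hk (Pi.isUnit_iff.1 hu k)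

theorem HasPentagon.fromBlocks {m n A : Type*} [Fintype m] [DecidableEq m] [Fintype n]
    [DecidableEq n] [CommRing A] (hm : HasPentagon (Matrix m m A) D)
    (hn : HasPentagon (Matrix n n A) E) : HasPentagon (Matrix (m ⊕ n) (m ⊕ n) A) (D ∪ E) := by
  obtain ⟨p, hpedge, hpchord⟩ := hm
  obtain ⟨q, hqedge, hqchord⟩ := hn
  have hunit (i j) : IsUnit (Matrix.fromBlocks (p i) 0 0 (q i) - Matrix.fromBlocks (p j) 0 0 (q j))
      ↔ IsUnit (p i - p j) ∧ IsUnit (q i - q j) := by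
    rw [sub_eq_add_neg, Matrix.fromBlocks_neg, Matrix.fromBlocks_add, neg_zero, neg_zero, add_zero,
      add_zero, ← sub_eq_add_neg, ← sub_eq_add_neg, Matrix.isUnit_fromBlocks_zero₂₁]
  refine ⟨fun i => Matrix.fromBlocks (p i) 0 0 (q i),
    fun i => (hunit _ _).2 ⟨hpedge i, hqedge i⟩, ?_⟩
  rintro i (hi | hi) hu
  · exact hpchord i hi ((hunit _ _).1 hu).1
  · exact hqchord i hi ((hunit _ _).1 hu).2

theorem HasExceptionalUnit.hasPentagon_pair [Nontrivial R] (h : HasExceptionalUnit R)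
    (a : Fin 5) : HasPentagon R {a, a + 1} := by
  obtain ⟨w, hw, hw'⟩ := h
  let walk : Fin 5 → R := ![0, 1, 0, 1, w]
  have hedge (i) : IsUnit (walk i - walk (i + 1)) := by
    fin_cases i <;> simp [walk, hw, hw']
  refine ⟨fun i => walk (i - a), fun i => ?_, ?_⟩
  · simpa only [add_sub_right_comm] using hedge (i - a)
  · rintro i (rfl | rfl)
    · simp [walk]
    · have hlast : a + 1 + 2 - a = 3 := by revert a; decide
      simp [walk, hlast]

theorem HasExceptionalUnit.hasPentagon_empty (h : HasExceptionalUnit R) : HasPentagon R ∅ := by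
  cases subsingleton_or_nontrivial R
  · exact ⟨0, fun i => isUnit_of_subsingleton _, by simp⟩
  · exact (h.hasPentagon_pair 0).mono (Set.empty_subset _)

end Pentagon

section MatrixPentagon

variable {A : Type*} [CommRing A]

theorem hasPentagon_matrix_fin_two [Nontrivial A] :
    HasPentagon (Matrix (Fin 2) (Fin 2) A) {2, 3, 4} := by
  refine ⟨![0, 1, !![0, 1; 0, 0], !![1, 1; 1, 1], !![0, 1; 1, 0]], fun i => ?_, ?_⟩
  · rw [Matrix.isUnit_iff_isUnit_det, Matrix.det_fin_two]
    fin_cases i <;> simp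
  · rintro i (rfl | rfl | rfl) <;> rw [Matrix.isUnit_iff_isUnit_det, Matrix.det_fin_two] <;> simp

theorem HasExceptionalUnit.hasPentagon_matrix_fin_two [Nontrivial A] (h : HasExceptionalUnit A) :
    HasPentagon (Matrix (Fin 2) (Fin 2) A) Set.univ := by
  obtain ⟨t, ht, ht'⟩ := h
  have ht'' : IsUnit (t - 1) := by simpa using ht'.neg
  refine ⟨![0, !![1, 0; t, 1], !![1, 1; 1, 1], !![1, 0; 0, 0], !![1, 1; t, 1]], fun i => ?_,
    fun i _ => ?_⟩ <;> rw [Matrix.isUnit_iff_isUnit_det, Matrix.det_fin_two]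
  · fin_cases i <;> simp [ht, ht', ht'']
  · fin_cases i <;> simp

theorem hasPentagon_matrix_fin_three [Nontrivial A] :
    HasPentagon (Matrix (Fin 3) (Fin 3) A) Set.univ := by
  refine ⟨![0, 1, !![0, 0, 0; 0, 0, 0; 0, 1, 0], !![1, 0, 0; 1, 0, 1; 0, 0, 0],
    !![0, 0, 1; 1, 0, 0; 0, 1, 0]], fun i => ?_, fun i _ => ?_⟩ <;>
    rw [Matrix.isUnit_iff_isUnit_det, Matrix.det_fin_three]
  · fin_cases i <;> simp
  · fin_cases i <;> simp

theorem union_pair_eq_univ : ({2, 3, 4} ∪ {0, 0 + 1} : Set (Fin 5)) = Set.univ := by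
  ext i
  fin_cases i <;> simp

theorem HasPentagon.of_card_eq {m n : Type*} [Fintype m] [DecidableEq m] [Fintype n]
    [DecidableEq n] {D : Set (Fin 5)} (h : HasPentagon (Matrix m m A) D)
    (hmn : Fintype.card m = Fintype.card n) : HasPentagon (Matrix n n A) D :=
  h.map (Matrix.reindexRingEquiv A (Fintype.equivOfCardEq hmn))

variable {n : Type*} [Fintype n] [DecidableEq n]

theorem hasPentagon_matrix_of_three_le_card [Nontrivial A] (hn : 3 ≤ Fintype.card n) :
    HasPentagon (Matrix n n A) Set.univ := by
  obtain hn | hn := hn.eq_or_lt'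
  · exact hasPentagon_matrix_fin_three.of_card_eq (by simp [hn])
  · obtain ⟨k, hk⟩ := Nat.exists_eq_add_of_le hn
    have hexc : HasExceptionalUnit (Matrix (Fin (k + 2)) (Fin (k + 2)) A) :=
      hasExceptionalUnit_matrix (by simp)
    rw [← union_pair_eq_univ]
    refine (hasPentagon_matrix_fin_two.fromBlocks (hexc.hasPentagon_pair 0)).of_card_eq ?_
    simp only [Fintype.card_sum, Fintype.card_fin]
    lia

theorem hasPentagon_matrix {F : Type*} [Field F] (hn : 2 ≤ Fintype.card n)
    (h : ¬(Fintype.card n = 2 ∧ Nat.card F = 2)) : HasPentagon (Matrix n n F) Set.univ := by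
  obtain hn | hn := hn.eq_or_lt'
  · have hF : HasExceptionalUnit F := hasExceptionalUnit_of_card_ne_two fun hF => h ⟨hn, hF⟩
    exact hF.hasPentagon_matrix_fin_two.of_card_eq (by simp [hn])
  · exact hasPentagon_matrix_of_three_le_card hn

end MatrixPentagon

section PiPentagon

variable {ι : Type*} {X : ι → Type*} [∀ k, Ring (X k)] {D : Set (Fin 5)}

theorem HasPentagon.pi_of_apply (hX : ∀ k, HasExceptionalUnit (X k)) {j : ι}
    (hj : HasPentagon (X j) D) : HasPentagon (∀ k, X k) D := by
  classical
  refine (HasPentagon.pi (D := Function.update (fun _ => ∅) j D) fun k => ?_).mono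
    (Set.subset_iUnion_of_subset j (by simp))
  obtain rfl | hk := eq_or_ne k j
  · simpa using hj
  · simpa [hk] using (hX k).hasPentagon_empty

theorem HasPentagon.pi_union_pair [∀ k, Nontrivial (X k)] [Nontrivial ι]
    (hX : ∀ k, HasExceptionalUnit (X k)) {j : ι} (hj : HasPentagon (X j) D) (a : Fin 5) :
    HasPentagon (∀ k, X k) (D ∪ {a, a + 1}) := by
  classical
  obtain ⟨j', hj'⟩ := exists_ne j
  refine (HasPentagon.pi (D := Function.update (fun _ => {a, a + 1}) j D) fun k => ?_).mono
    (Set.union_subset (Set.subset_iUnion_of_subset j (by simp))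
      (Set.subset_iUnion_of_subset j' (by simp [hj'])))
  obtain rfl | hk := eq_or_ne k j
  · simpa using hj
  · simpa [hk] using (hX k).hasPentagon_pair a

theorem hasPentagon_pi_of_two_lt_card [Fintype ι] [∀ k, Nontrivial (X k)]
    (hX : ∀ k, HasExceptionalUnit (X k)) (hι : 2 < Fintype.card ι) :
    HasPentagon (∀ k, X k) Set.univ := by
  obtain ⟨g⟩ : Nonempty (Fin 3 ↪ ι) :=
    Function.Embedding.nonempty_of_card_le ((Fintype.card_fin 3).trans_le hι)
  let a : ι → Fin 5 := Function.extend g ![0, 2, 4] 0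
  have ha (i) : a (g i) = ![0, 2, 4] i := g.injective.extend_apply _ _ i
  refine (HasPentagon.pi fun k => (hX k).hasPentagon_pair (a k)).mono fun i _ => ?_
  obtain ⟨j, hj⟩ : ∃ j : Fin 3, i ∈ ({a (g j), a (g j) + 1} : Set (Fin 5)) := by
    simp only [ha, Fin.exists_fin_succ]
    fin_cases i <;> simp
  exact Set.mem_iUnion_of_mem (g j) hj

end PiPentagon

section CayleyGraph

instance isLocalHom_mk_jacobson (R : Type*) [Ring R] :
    IsLocalHom (Ideal.Quotient.mk (Ring.jacobson R)) where
  map_nonunit a ha := by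
    have left_inv {b : R} (hb : Ideal.Quotient.mk (Ring.jacobson R) b = 1) : ∃ c, c * b = 1 := by
      rw [← map_one (Ideal.Quotient.mk _), Ideal.Quotient.eq, ← Ideal.jacobson_bot] at hb
      obtain ⟨c, hc⟩ := Ideal.exists_mul_sub_mem_of_sub_one_mem_jacobson _ hb
      exact ⟨c, sub_eq_zero.1 hc⟩
    -- A left inverse of an element of `1 + Rad(R)` lies in `1 + Rad(R)`, too.
    have isUnit_of {b : R} (hb : Ideal.Quotient.mk (Ring.jacobson R) b = 1) : IsUnit b := by
      obtain ⟨c, hcb⟩ := left_inv hb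
      have hc : Ideal.Quotient.mk (Ring.jacobson R) c = 1 := by
        simpa [hb] using congrArg (Ideal.Quotient.mk (Ring.jacobson R)) hcb
      obtain ⟨d, hdc⟩ := left_inv hc
      exact isUnit_iff_exists_and_exists.2 ⟨⟨c, left_inv_eq_right_inv hdc hcb ▸ hdc⟩, c, hcb⟩
    obtain ⟨u, hu⟩ := ha
    obtain ⟨b, hb⟩ := Ideal.Quotient.mk_surjective (↑u⁻¹ : R ⧸ Ring.jacobson R)
    obtain ⟨v, hv⟩ : IsUnit (a * b) := isUnit_of (by simp [← hu, hb])
    obtain ⟨w, hw⟩ : IsUnit (b * a) := isUnit_of (by simp [← hu, hb])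
    refine isUnit_iff_exists_and_exists.2 ⟨⟨b * ↑v⁻¹, ?_⟩, ↑w⁻¹ * b, ?_⟩
    · rw [← mul_assoc, ← hv, v.mul_inv]
    · rw [mul_assoc, ← hw, w.inv_mul]

variable {R T : Type*} [Ring R] [Ring T]

theorem unitaryCayleyGraph_adj_iff [Nontrivial T] (φ : R →+* T) [IsLocalHom φ] {a b : R} :
    (unitaryCayleyGraph R).Adj a b ↔ IsUnit (φ a - φ b) := by
  rw [← map_sub, isUnit_map_iff]
  refine ⟨fun h => h.2, fun h => ⟨?_, h⟩⟩
  rintro rfl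
  exact not_isUnit_zero (M₀ := T) (by simpa using h.map φ)

theorem colorable_unitaryCayleyGraph [Finite T] [Nontrivial T] (φ : R →+* T) :
    (unitaryCayleyGraph R).Colorable (Nat.card T) := by
  have := Fintype.ofFinite T
  rw [Nat.card_eq_fintype_card]
  refine (Coloring.mk φ fun {a b} hab h => ?_).colorable
  exact not_isUnit_zero (M₀ := T) (by simpa [h] using hab.2.map φ)

theorem HasPentagon.not_isPerfect [Finite R] (h : HasPentagon R Set.univ) :
    ¬IsPerfect (unitaryCayleyGraph R) := by
  obtain ⟨p, hedge, hchord⟩ := h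
  have hR : Nontrivial R :=
    not_subsingleton_iff_nontrivial.1 fun _ => hchord 0 trivial (isUnit_of_subsingleton _)
  have hadj {i j} : (unitaryCayleyGraph R).Adj (p i) (p j) ↔ IsUnit (p i - p j) :=
    unitaryCayleyGraph_adj_iff (RingHom.id R)
  refine fun hperf => not_isPerfect_cycleGraph_five (hperf.comap p fun i j => ?_)
  have hnext : ∀ i, (cycleGraph 5).Adj i (i + 1) := by decide
  have hskip : ∀ i, ¬(cycleGraph 5).Adj i (i + 2) := by decide
  have hcases : ∀ i j : Fin 5, i = j ∨ j = i + 1 ∨ i = j + 1 ∨ j = i + 2 ∨ i = j + 2 := by decide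
  rcases hcases i j with rfl | rfl | rfl | rfl | rfl
  · simp
  · simp [hadj, hnext, hedge]
  · simp [(cycleGraph 5).adj_comm (j + 1), hadj, IsUnit.sub_iff (x := p (j + 1)), hnext, hedge]
  · simp [hadj, hskip, hchord]
  · simp [(cycleGraph 5).adj_comm (j + 2), hadj, IsUnit.sub_iff (x := p (j + 2)), hskip, hchord]

/-- Coordinates that identify the unitary Cayley graph of `M_2(𝔽_2)` with the `4 × 4` rook's graph:
the units together with `0` form the union of two complementary planes, each of which is the common
kernel of two of the coordinates. -/
def rookCoordinates (M : Matrix (Fin 2) (Fin 2) (ZMod 2)) : (ZMod 2 × ZMod 2) × (ZMod 2 × ZMod 2) :=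
  ((M 0 1 + M 1 0, M 0 0 + M 0 1 + M 1 1), (M 0 0 + M 1 1, M 0 0 + M 0 1 + M 1 0))

theorem boxProd_top_adj_rookCoordinates (M N : Matrix (Fin 2) (Fin 2) (ZMod 2)) :
    ((⊤ : SimpleGraph (ZMod 2 × ZMod 2)) □ (⊤ : SimpleGraph (ZMod 2 × ZMod 2))).Adj
      (rookCoordinates M) (rookCoordinates N) ↔ IsUnit (M - N) := by
  rw [Matrix.isUnit_iff_isUnit_det, isUnit_iff_ne_zero, Matrix.det_fin_two]
  simp only [boxProd_adj, top_adj, rookCoordinates, Prod.mk.injEq, Matrix.sub_apply, ne_eq]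
  generalize M 0 0 = a, M 0 1 = b, M 1 0 = c, M 1 1 = d, N 0 0 = a', N 0 1 = b', N 1 0 = c',
    N 1 1 = d'
  revert a b c d a' b' c' d'
  decide

theorem isPerfect_of_isLocalHom_matrix_two [Finite R]
    (φ : R →+* Matrix (Fin 2) (Fin 2) (ZMod 2)) [IsLocalHom φ] :
    IsPerfect (unitaryCayleyGraph R) :=
  isPerfect_boxProd_top.comap (fun a => rookCoordinates (φ a)) fun _ _ =>
    (unitaryCayleyGraph_adj_iff φ).trans (boxProd_top_adj_rookCoordinates _ _).symm

theorem isPerfect_of_isLocalHom_pi [Finite R] {ι : Type*} [Fintype ι] (hι : Fintype.card ι ≤ 2)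
    {K : ι → Type*} [∀ i, DivisionRing (K i)] [∀ i, Finite (K i)] (φ : R →+* ∀ i, K i)
    [IsLocalHom φ] : IsPerfect (unitaryCayleyGraph R) := by
  rcases isEmpty_or_nonempty ι with _ | ⟨⟨i⟩⟩
  · have hR : Subsingleton R := subsingleton_of_zero_eq_one <|
      isUnit_zero_iff.1 ((isUnit_map_iff φ 0).1 (isUnit_of_subsingleton _))
    exact .of_isBipartite ⟨Coloring.mk 0 fun hab => (hab.ne (Subsingleton.elim _ _)).elim⟩
  · obtain ⟨j, hj⟩ : ∃ j, ∀ k, k = i ∨ k = j := by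
      by_contra! h
      obtain ⟨k, hki, -⟩ := h i
      obtain ⟨l, hli, hlk⟩ := h k
      exact hι.not_gt (Fintype.two_lt_card_iff.2 ⟨i, k, l, hki.symm, hli.symm, hlk.symm⟩)
    have : Nontrivial (∀ i, K i) := Pi.nontrivial_at i
    refine isPerfect_compl_boxProd_top.comap (fun a => (φ a i, φ a j)) fun a b => ?_
    rw [unitaryCayleyGraph_adj_iff φ, compl_boxProd_top_adj, Pi.isUnit_iff]
    simp only [Pi.sub_apply, isUnit_iff_ne_zero, sub_ne_zero]
    exact ⟨fun h => ⟨h i, h j⟩, fun h k => by rcases hj k with rfl | rfl <;> tauto⟩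

end CayleyGraph

section MainTheorem

theorem nonempty_matrix_ringEquiv_zmod_two {n F : Type*} [Fintype n] [Field F]
    (hn : Fintype.card n = 2) (hF : Nat.card F = 2) :
    Nonempty (Matrix n n F ≃+* Matrix (Fin 2) (Fin 2) (ZMod 2)) := by
  have : Finite F := Nat.finite_of_card_ne_zero (by lia)
  have := Fintype.ofFinite F
  rw [Nat.card_eq_fintype_card] at hF
  exact ⟨(Matrix.reindexRingEquiv F (Fintype.equivFinOfCardEq hn)).trans
    (ZMod.ringEquivOfPrime F Nat.prime_two hF).symm.mapMatrix⟩

theorem hasPentagon_pi_prod_pi_matrix {ι κ : Type*} [Fintype ι] {K : ι → Type*}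
    [∀ i, Field (K i)] {n : κ → Type*} [∀ j, Fintype (n j)] [∀ j, DecidableEq (n j)]
    {F : κ → Type*} [∀ j, Field (F j)] (hK : ∀ i, Nat.card (K i) ≠ 2)
    (hn : ∀ j, 2 ≤ Fintype.card (n j)) (hικ : IsEmpty κ → 2 < Fintype.card ι)
    (h : IsEmpty (((∀ i, K i) × ∀ j, Matrix (n j) (n j) (F j)) ≃+*
      Matrix (Fin 2) (Fin 2) (ZMod 2))) :
    HasPentagon ((∀ i, K i) × ∀ j, Matrix (n j) (n j) (F j)) Set.univ := by
  have hKexc (i) : HasExceptionalUnit (K i) := hasExceptionalUnit_of_card_ne_two (hK i)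
  have hMexc (j) : HasExceptionalUnit (Matrix (n j) (n j) (F j)) := hasExceptionalUnit_matrix (hn j)
  have hKempty := (HasExceptionalUnit.pi hKexc).hasPentagon_empty
  have hMempty := (HasExceptionalUnit.pi hMexc).hasPentagon_empty
  rcases isEmpty_or_nonempty κ with hκ | ⟨⟨j⟩⟩
  · simpa using (hasPentagon_pi_of_two_lt_card hKexc (hικ hκ)).prod hMempty
  by_cases hj : Fintype.card (n j) = 2 ∧ Nat.card (F j) = 2
  · have hjpentagon : HasPentagon (Matrix (n j) (n j) (F j)) {2, 3, 4} :=
      hasPentagon_matrix_fin_two.of_card_eq (by simp [hj.1])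
    rw [← union_pair_eq_univ]
    rcases isEmpty_or_nonempty ι with hι | ⟨⟨i⟩⟩
    · rcases subsingleton_or_nontrivial κ with hκ | hκ
      · let := uniqueOfSubsingleton j
        obtain ⟨e⟩ := nonempty_matrix_ringEquiv_zmod_two hj.1 hj.2
        exact (h.false ((RingEquiv.zeroRingProd _ _).symm.trans
          ((RingEquiv.piUnique fun j => Matrix (n j) (n j) (F j)).trans e))).elim
      · have hnonempty (k) : Nonempty (n k) := Fintype.card_pos_iff.1 (two_pos.trans_le (hn k))
        have hnontrivial (k) : Nontrivial (Matrix (n k) (n k) (F k)) := inferInstance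
        simpa using hKempty.prod (.pi_union_pair hMexc hjpentagon 0)
    · have : Nontrivial (∀ i, K i) := Pi.nontrivial_at i
      rw [Set.union_comm]
      exact ((HasExceptionalUnit.pi hKexc).hasPentagon_pair 0).prod (.pi_of_apply hMexc hjpentagon)
  · simpa using hKempty.prod (.pi_of_apply hMexc (hasPentagon_matrix (hn j) hj))

end MainTheorem

end UnitaryCayley

open UnitaryCayley

theorem mainTheorem1
    (R : Type*) [Ring R] [Finite R]
    (s r : ℕ)
    (K : Fin s → Type*) [∀ i, Field (K i)] [∀ i, Finite (K i)]
    (hK : Monotone fun i => Nat.card (K i))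
    (F : Fin r → Type*) [∀ j, Field (F j)] [∀ j, Finite (F j)]
    (d : Fin r → ℕ) (hd : ∀ j, 2 ≤ d j)
    (e : UnitaryCayley.Semisimplification R ≃+*
      ((∀ i, K i) × (∀ j, Matrix (Fin (d j)) (Fin (d j)) (F j)))) :
    (UnitaryCayley.IsPerfect (UnitaryCayley.unitaryCayleyGraph R) ↔
      ((∃ h : 0 < s, Nat.card (K ⟨0, h⟩) = 2) ∨
        (r = 0 ∧ s ≤ 2) ∨
        Nonempty (UnitaryCayley.Semisimplification R ≃+*
          Matrix (Fin 2) (Fin 2) (ZMod 2)))) ∧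
    ((∃ h : 0 < s, Nat.card (K ⟨0, h⟩) = 2) →
      (UnitaryCayley.unitaryCayleyGraph R).IsBipartite) := by
  let π := Ideal.Quotient.mk (Ring.jacobson R)
  have hbip : (∃ h : 0 < s, Nat.card (K ⟨0, h⟩) = 2) → (unitaryCayleyGraph R).IsBipartite :=
    fun ⟨_, h2⟩ => (colorable_unitaryCayleyGraph
      ((Pi.evalRingHom K _).comp ((RingHom.fst _ _).comp (e.toRingHom.comp π)))).mono h2.le
  refine ⟨⟨fun hperf => ?_, ?_⟩, hbip⟩
  · by_contra! ⟨hcard, hrs, hiso⟩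
    have hK2 (i) : Nat.card (K i) ≠ 2 := by
      have hlt : 1 < Nat.card (K ⟨0, i.pos⟩) := Finite.one_lt_card
      have hle : Nat.card (K ⟨0, i.pos⟩) ≤ Nat.card (K i) := hK (Fin.mk_le_of_le_val i.1.zero_le)
      have hne := hcard i.pos
      lia
    have hpentagon := hasPentagon_pi_prod_pi_matrix (F := F) hK2 (by simpa using hd)
      (by simpa [← Fintype.card_eq_zero_iff] using hrs) ⟨fun f => hiso.false (e.trans f)⟩
    exact ((hpentagon.map e.symm).of_surjective π Ideal.Quotient.mk_surjective).not_isPerfect hperf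
  · rintro (h2 | ⟨rfl, hs⟩ | ⟨⟨f⟩⟩)
    · exact .of_isBipartite (hbip h2)
    · let f := e.trans (RingEquiv.prodZeroRing (∀ i, K i) _).symm
      exact isPerfect_of_isLocalHom_pi (by simpa using hs) ((RingHomClass.toRingHom f).comp π)
    · exact isPerfect_of_isLocalHom_matrix_two ((RingHomClass.toRingHom f).comp π)
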